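/- Memory model. Let $G$ be a finite directed graph, where an edge $(u,v)$ means that $u$ is an operand of the operation $v$. There is a fast memory holding at most $M$ elements and an infinite slow memory, both empty at the start. Every vertex is evaluated exactly once (no recomputation), and when a vertex is evaluated all its operands must be in fast memory; the result may take the place of an operand. Elements can be dropped from fast memory at no cost, and a dropped element can come back only by being read from slow memory, to which it must have been written before. Only nontrivial I/O is counted: each transfer of one element from slow to fast memory (read) or from fast to slow memory (write) costs one I/O, whereas inputs (sources) come directly from the user into fast memory and outputs (sinks) are reported to the user when computed, both for free. For a topological order $X$ of the vertices let $J_G(X)$ be the least number of I/Os with which $G$ can be evaluated in the order $X$ ($+\infty$ if this is impossible), and let $J^*_G=\inf_X J_G(X)$ over all topological orders $X$. Let $B_l$ be the butterfly graph, the computation graph of the $2^l$-point FFT: its vertices are the pairs $(i,w)$ with $0\le i\le l$ and $w\in\{0,1\}^l$, with an edge from $(i,w)$ to $(i+1,w')$ exactly if $w$ and $w'$ agree in all positions except possibly the one with index $i$ (positions are indexed $0,\dots,l-1$). For $M\ge 2$ put $$b(l,M)=(l+1)2^l\left(1-\cos\left(\frac{\pi}{2\log_2 M+1}\right)-\frac{4}{l+1}\right).$$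 (1) For all integers $l\ge 0$ and $M\ge 2$, $$J^*_{B_l}\ \ge\ b(l,M).$$ (2) In the regime $M\ll l$ this bound is $\Omega\!\left(l2^l/\log^2 M\right)$: there are an absolute constant $c>0$ and an $l_0$ such that for all integers $l\ge l_0$ and $2\le M\le l$, $$b(l,M)\ \ge\ c\,\frac{l2^l}{\log_2^2 M},\qquad\text{that is,}\qquad b(l,M)\ \ge\ c\cdot\frac{1}{\log_2 M}\cdot\frac{l2^l}{\log_2 M},$$ so that $b(l,M)$ is at most a factor of order $1/\log M$ below the expression $l2^l/\log M$ of the lower bound of Hong and Kung. -/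

import Mathlib

/-!
# Two-level memory model for computation graphs, and the butterfly graph

A computation graph is a directed graph: an edge from `u` to `v` says that `u` is an operand of the
operation `v`. Sources are inputs, sinks are outputs.
-/

namespace IOModel

/-- Runs of a computation with a fast memory of `M` elements and an infinite slow memory.

`Run G M o c F S` says: starting with both memories empty, it is possible to have evaluated exactly
the vertices of the list `o`, in this order and each of them once, with exactly `c` I/O operations,
so that now fast memory holds (the results of) the vertices in `F` and slow memory those in `S`.

Elements may be dropped from fast memory at no cost whenever a new one arrives; an element that was
dropped can come back only by being read from slow memory, where it must have been written before.
* `eval`: a vertex that has not been evaluated yet is evaluated; all its operands are in fast memory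
  at that moment. Its result may overwrite an operand. This is free: inputs come directly from the
  user, and outputs are reported to the user at once, so they need not be kept.
* `read`: one I/O, copies an element from slow to fast memory.
* `write`: one I/O, copies an element from fast to slow memory. -/
inductive Run {V : Type*} [DecidableEq V] (G : Digraph V) (M : ℕ) :
    List V → ℕ → Finset V → Finset V → Prop
  | start : Run G M [] 0 ∅ ∅
  | eval {o : List V} {c : ℕ} {F S : Finset V} (h : Run G M o c F S) (v : V) (F' : Finset V)
      (hv : v ∉ o) (hop : ∀ u, G.Adj u v → u ∈ F) (hF : F' ⊆ insert v F) (hM : F'.card ≤ M) :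
      Run G M (o ++ [v]) c F' S
  | read {o : List V} {c : ℕ} {F S : Finset V} (h : Run G M o c F S) (v : V) (F' : Finset V)
      (hv : v ∈ S) (hF : F' ⊆ insert v F) (hM : F'.card ≤ M) :
      Run G M o (c + 1) F' S
  | write {o : List V} {c : ℕ} {F S : Finset V} (h : Run G M o c F S) (v : V) (hv : v ∈ F) :
      Run G M o (c + 1) F (insert v S)

/-- `X i` is the vertex evaluated at time-step `i`; the order is valid if it is topological, i.e.
every vertex comes after its operands. -/
def IsTopologicalOrder {V : Type*} [Fintype V] (G : Digraph V)
    (X : Fin (Fintype.card V) ≃ V) : Prop :=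
  ∀ u v, G.Adj u v → X.symm u < X.symm v

/-- `J_G(X)`: the least number of nontrivial I/Os with which all vertices of `G` can be evaluated in
the order `X`, with a fast memory of `M` elements (`⊤` if this is impossible). -/
noncomputable def orderIO {V : Type*} [Fintype V] [DecidableEq V] (G : Digraph V) (M : ℕ)
    (X : Fin (Fintype.card V) ≃ V) : ℕ∞ :=
  ⨅ (c : ℕ) (_ : ∃ F S : Finset V, Run G M (List.ofFn X) c F S), (c : ℕ∞)

/-- `J_G^*`: the optimal nontrivial I/O over all topological evaluation orders. -/
noncomputable def optIO {V : Type*} [Fintype V] [DecidableEq V] (G : Digraph V) (M : ℕ) : ℕ∞ :=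
  ⨅ (X : Fin (Fintype.card V) ≃ V) (_ : IsTopologicalOrder G X), orderIO G M X

/-- The (unwrapped) butterfly graph `B_l`, the computation graph of the `2 ^ l`-point FFT. It has
`l + 1` columns `0, …, l` of `2 ^ l` vertices each, and `(i, w)` is the vertex of column `i` whose row
is the binary word `w`. There is an edge from `(i, w)` to `(i + 1, w')` exactly if `w` and `w'` agree
outside bit `i`. Thus the columns `0, …, l - 1` form two copies of `B_{l-1}`, distinguished by the
last bit, and the last column joins corresponding rows of the two copies. -/
def butterfly (l : ℕ) : Digraph (Fin (l + 1) × (Fin l → Bool)) where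
  Adj p q := (q.1 : ℕ) = (p.1 : ℕ) + 1 ∧ ∀ b : Fin l, (b : ℕ) ≠ (p.1 : ℕ) → p.2 b = q.2 b

/-- The closed form `(l + 1) 2 ^ l (1 - cos (π / (2 log₂ M + 1)) - 4 / (l + 1))`. -/
noncomputable def fftBound (l M : ℕ) : ℝ :=
  ((l : ℝ) + 1) * 2 ^ l *
    (1 - Real.cos (Real.pi / (2 * Real.logb 2 (M : ℝ) + 1)) - 4 / ((l : ℝ) + 1))

end IOModel

/-!
# An I/O lower bound for the butterfly graph

The bound follows from an isoperimetric inequality for the butterfly and an argument by segments. Cut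
the evaluation order into segments of `s` consecutive vertices. The operands that a segment takes from
outside are in fast memory at its start, except those that are read, and the results that it hands on
are in fast memory at its end, except those that are written. So a segment with at least `D` such
operands and `D'` such results costs `(D - M) + (D' - M)` I/Os (`Run.segment_bound`).

The isoperimetric inequality (`card_le_closureBound`) says that the vertices that can be computed from
`D` given ones number at most `D (1 + log₂ D)`, the given ones included. Its proof is by induction on the
dimension: if the two halves of a butterfly contain `a` and `b` of the given vertices, then at most
`2 min (a, b)` vertices of the last column are computed, and
`a log₂ a + b log₂ b + 2 min (a, b) ≤ (a + b) log₂ (a + b)` because the binary entropy is concave. Applied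
to the butterfly and to its reversal, it bounds operands and results of a segment from below
(`le_card_operandBoundary`, `le_card_resultBoundary`). Inputs and outputs are exceptions which, summed
over all segments, cost at most `3 · 2 ^ l`; the incomplete last segment costs at most another `2 ^ l`,
unless the butterfly is so small that the bound is negative. Together
they are the term `4 / (l + 1)` of the closed form.

It remains to choose `s`. For `M = 2`, `s = 8` gives the coefficient `1 / 2 = 1 - cos (π / 3)`. For `M ≥ 3`
and `m = log₂ M`, `s ≈ 4 M log₂ (4 M)` gives `(5 / 4) / (m + 2)`, which exceeds
`(π / (2 m + 1)) ^ 2 / 2 ≥ 1 - cos (π / (2 m + 1))`. The asymptotic statement uses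
`1 - cos x ≥ 2 x ^ 2 / π ^ 2` for `|x| ≤ π`, and that `(log₂ l) ^ 2` is small against `l`.
-/

namespace IOModel

/-! ### Cutting runs -/

section Runs

variable {V : Type*} [DecidableEq V] {G : Digraph V} {M : ℕ}

theorem Run.card_fast_le {o : List V} {c : ℕ} {F S : Finset V} (h : Run G M o c F S) :
    F.card ≤ M := by
  induction h with
  | start => simp
  | eval _ _ _ _ _ _ hM => exact hM
  | read _ _ _ _ _ hM => exact hM
  | write _ _ _ ih => exact ih

theorem Run.nodup {o : List V} {c : ℕ} {F S : Finset V} (h : Run G M o c F S) : o.Nodup := by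
  induction h with
  | start => simp
  | eval _ v _ hv _ _ _ ih => exact List.nodup_append.2 ⟨ih, by simp, by grind⟩
  | read _ _ _ _ _ _ ih => exact ih
  | write _ _ _ ih => exact ih

theorem Run.mem_order {o : List V} {c : ℕ} {F S : Finset V} (h : Run G M o c F S) {u : V}
    (hu : u ∈ F ∨ u ∈ S) : u ∈ o := by
  induction h with
  | start => simp at hu
  | eval _ v _ _ _ hF _ ih => grind
  | read _ v _ hv hF _ ih => grind
  | write _ v hv ih => grind

theorem Run.operand_mem_order {o : List V} {c : ℕ} {F S : Finset V} (h : Run G M o c F S)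
    {u v : V} (hv : v ∈ o) (huv : G.Adj u v) : u ∈ o := by
  induction h with
  | start => simp at hv
  | eval h w _ _ hop _ _ ih =>
    have := @Run.mem_order _ _ _ _ _ _ _ _ h u
    grind
  | read _ _ _ _ _ _ ih => exact ih hv
  | write _ _ _ ih => exact ih hv

/-- A run can be cut at every prefix `o₁` of its order. Here `R` holds the elements read and `W` those
written after the cut. What is used or stored after the cut was in memory at the cut, or is
evaluated after it: a lost element never comes back. -/
theorem Run.exists_segment {o : List V} {c : ℕ} {F S : Finset V} (h : Run G M o c F S)
    (o₁ T : List V) (ho : o = o₁ ++ T) :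
    ∃ (c₁ : ℕ) (F₁ S₁ R W : Finset V), Run G M o₁ c₁ F₁ S₁ ∧ c₁ + R.card + W.card ≤ c ∧
      (∀ u ∈ F, u ∈ F₁ ∨ u ∈ R ∨ u ∈ T) ∧ (∀ u ∈ S, u ∈ S₁ ∨ u ∈ W) ∧
      (∀ u, u ∈ F ∨ u ∈ S → u ∈ F₁ ∨ u ∈ S₁ ∨ u ∈ T) ∧
      ∀ v ∈ T, ∀ u, G.Adj u v →
        (u ∈ F₁ ∨ u ∈ R ∨ u ∈ T) ∧ (u ∈ F₁ ∨ u ∈ S₁ ∨ u ∈ T) := by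
  induction h generalizing o₁ T with
  | start =>
    obtain ⟨rfl, rfl⟩ : o₁ = [] ∧ T = [] := by simpa using ho.symm
    exact ⟨0, ∅, ∅, ∅, ∅, .start, by simp⟩
  | @eval o c F S h v F' hv hop hF hM ih =>
    rcases List.eq_nil_or_concat T with rfl | ⟨T', v', rfl⟩
    · obtain rfl : o₁ = o ++ [v] := by simpa using ho.symm
      refine ⟨c, F', S, ∅, ∅, .eval h v F' hv hop hF hM, by simp, ?_, ?_, ?_, ?_⟩ <;> grind
    · rw [List.concat_eq_append, ← List.append_assoc] at ho
      obtain ⟨rfl, hvv⟩ := List.append_inj' ho rfl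
      obtain rfl : v = v' := by simpa using hvv
      obtain ⟨c₁, F₁, S₁, R, W, h₁, hc, a1, a2, a3, a4⟩ := ih o₁ T' rfl
      refine ⟨c₁, F₁, S₁, R, W, h₁, hc, ?_, a2, ?_, ?_⟩
      · grind
      · grind
      · intro w hw u huw
        grind
  | @read o c F S h v F' hv hF hM ih =>
    obtain ⟨c₁, F₁, S₁, R, W, h₁, hc, a1, a2, a3, a4⟩ := ih o₁ T ho
    refine ⟨c₁, F₁, S₁, insert v R, W, h₁, ?_, ?_, a2, ?_, ?_⟩
    · have := Finset.card_insert_le v R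
      omega
    · grind
    · grind
    · grind
  | @write o c F S h v hv ih =>
    obtain ⟨c₁, F₁, S₁, R, W, h₁, hc, a1, a2, a3, a4⟩ := ih o₁ T ho
    refine ⟨c₁, F₁, S₁, R, insert v W, h₁, ?_, a1, ?_, ?_, a4⟩
    · have := Finset.card_insert_le v W
      omega
    · grind
    · grind

/-- Every evaluated vertex that is an operand of a vertex still to be evaluated is in memory. -/
def KeepsNeeded (G : Digraph V) (o : List V) (F S : Finset V) : Prop :=
  ∀ u ∈ o, ∀ v, v ∉ o → G.Adj u v → u ∈ F ∨ u ∈ S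

/-- The cut of a run at a prefix of its order, for a run that keeps what it needs. -/
theorem Run.exists_segment_of_keepsNeeded {o : List V} {c : ℕ} {F S : Finset V}
    (h : Run G M o c F S) (hneed : KeepsNeeded G o F S) (o₁ T : List V) (ho : o = o₁ ++ T) :
    ∃ (c₁ : ℕ) (F₁ S₁ R W : Finset V), Run G M o₁ c₁ F₁ S₁ ∧ KeepsNeeded G o₁ F₁ S₁ ∧
      c₁ + R.card + W.card ≤ c ∧ (∀ u ∈ S, u ∈ S₁ ∨ u ∈ W) ∧
      ∀ v ∈ T, ∀ u, G.Adj u v → u ∈ F₁ ∨ u ∈ R ∨ u ∈ T := by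
  have hnd : (o₁ ++ T).Nodup := ho ▸ h.nodup
  have hmem : ∀ x, x ∈ o ↔ x ∈ o₁ ∨ x ∈ T := fun x => by rw [ho]; simp
  obtain ⟨c₁, F₁, S₁, R, W, h₁, hc, a1, a2, a3, a4⟩ := h.exists_segment o₁ T ho
  refine ⟨c₁, F₁, S₁, R, W, h₁, ?_, hc, a2, fun v hv u huv => (a4 v hv u huv).1⟩
  intro u hu v hv huv
  have : u ∉ T := fun hu' => List.disjoint_of_nodup_append hnd hu hu'
  by_cases hvT : v ∈ T
  · have := (a4 v hvT u huv).2
    tauto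
  · have := a3 u (hneed u ((hmem u).2 (.inl hu)) v (by rw [hmem]; tauto) huv)
    tauto

end Runs

/-! ### I/O forced by the boundaries of segments -/

section Segments

variable {V : Type*} [Fintype V] [DecidableEq V]

/-- The operands outside `T` of the vertices in `T`. -/
noncomputable def operandBoundary (G : Digraph V) (T : Finset V) : Finset V :=
  open Classical in {u | u ∉ T ∧ ∃ v ∈ T, G.Adj u v}

/-- The vertices in `T` that are operands of some vertex outside `T`. -/
noncomputable def resultBoundary (G : Digraph V) (T : Finset V) : Finset V :=
  open Classical in {u | u ∈ T ∧ ∃ v ∉ T, G.Adj u v}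

variable {G : Digraph V} {M : ℕ}

/-- If the first `o.length` vertices of an order are evaluated and every result still needed is in
memory, then the I/O so far is at least the sum, over disjoint segments of `s` consecutive vertices,
of the reads and writes that the boundaries of the segments force. The weights `a` and `b` make up
for inputs and outputs, which come and go without I/O. The subtractions truncate: a boundary of at
most `M` elements forces nothing. -/
theorem Run.segment_bound {s D D' : ℕ} {a b : V → ℕ}
    (hIn : ∀ T : Finset V, T.card = s → D ≤ (operandBoundary G T).card + ∑ v ∈ T, a v)
    (hOut : ∀ T : Finset V, T.card = s → D' ≤ (resultBoundary G T).card + ∑ v ∈ T, b v)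
    (q : ℕ) {o : List V} {c : ℕ} {F S : Finset V} (h : Run G M o c F S)
    (hneed : KeepsNeeded G o F S) (hlen : q * s ≤ o.length) :
    q * ((D - M) + (D' - M)) ≤ c + ∑ v ∈ o.toFinset, (a v + b v) := by
  induction q generalizing o c F S with
  | zero => simp
  | succ q ih =>
    -- An order of exactly `q + 1` segments is cut before the last one; a longer one is first cut
    -- after `q + 1` segments.
    have key : ∀ {o : List V} {c : ℕ} {F S : Finset V}, Run G M o c F S →
        KeepsNeeded G o F S → o.length = (q + 1) * s →
        (q + 1) * ((D - M) + (D' - M)) ≤ c + ∑ v ∈ o.toFinset, (a v + b v) := by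
      intro o c F S h hneed hlen
      have ho : o = o.take (q * s) ++ o.drop (q * s) := (List.take_append_drop _ _).symm
      set o₁ := o.take (q * s)
      set T := o.drop (q * s)
      have hnd : (o₁ ++ T).Nodup := ho ▸ h.nodup
      have hdisj : ∀ x ∈ o₁, x ∉ T := fun x hx hx' => List.disjoint_of_nodup_append hnd hx hx'
      have hTnd : T.Nodup := (List.nodup_append.1 hnd).2.1
      obtain ⟨c₁, F₁, S₁, R, W, h₁, hneed₁, hc, hS, hT⟩ :=
        h.exists_segment_of_keepsNeeded hneed o₁ T ho
      have hTlen : T.length = s := by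
        simp only [T, List.length_drop, hlen]
        rw [add_mul, one_mul]
        omega
      have hmem : ∀ x, x ∈ o ↔ x ∈ o₁ ∨ x ∈ T := fun x => by rw [ho]; simp
      have h1len : q * s ≤ o₁.length := by
        simp only [o₁, List.length_take, hlen, add_mul]
        omega
      have hbound := ih h₁ hneed₁ h1len
      have hTc : T.toFinset.card = s := by rw [List.toFinset_card_of_nodup hTnd, hTlen]
      -- What `T` takes from outside is in fast memory at its start or read during it.
      have hin : (operandBoundary G T.toFinset).card ≤ M + R.card := by
        refine (Finset.card_le_card (t := F₁ ∪ R) ?_).trans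
          ((Finset.card_union_le _ _).trans (by have := h₁.card_fast_le; omega))
        intro u hu
        simp only [operandBoundary, Finset.mem_filter, Finset.mem_univ, true_and,
          List.mem_toFinset] at hu
        obtain ⟨huT, v, hv, huv⟩ := hu
        have := hT v hv u huv
        simp only [Finset.mem_union]
        tauto
      -- What `T` hands on is in fast memory at its end or written during it.
      have hout : (resultBoundary G T.toFinset).card ≤ M + W.card := by
        refine (Finset.card_le_card (t := F ∪ W) ?_).trans
          ((Finset.card_union_le _ _).trans (by have := h.card_fast_le; omega))
        intro u hu
        simp only [resultBoundary, Finset.mem_filter, Finset.mem_univ, true_and,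
          List.mem_toFinset] at hu
        obtain ⟨huT, v, hv, huv⟩ := hu
        have hu1 : u ∉ o₁ := fun h' => hdisj u h' huT
        have hv1 : v ∉ o₁ := fun h' => hu1 (h₁.operand_mem_order h' huv)
        have h2 := hneed u ((hmem u).2 (.inr huT)) v (by rw [hmem]; tauto) huv
        have h3 : u ∉ S₁ := fun h' => hu1 (h₁.mem_order (.inr h'))
        have h4 := hS u
        simp only [Finset.mem_union]
        tauto
      have e1 := hIn _ hTc
      have e2 := hOut _ hTc
      have hsum : ∑ v ∈ o.toFinset, (a v + b v) = ∑ v ∈ o₁.toFinset, (a v + b v) +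
          (∑ v ∈ T.toFinset, a v + ∑ v ∈ T.toFinset, b v) := by
        rw [← Finset.sum_add_distrib, ← Finset.sum_union]
        · congr 1
          ext x
          simp [hmem]
        · rw [Finset.disjoint_left]
          simpa using hdisj
      rw [hsum, add_mul, one_mul]
      omega
    have ho : o = o.take ((q + 1) * s) ++ o.drop ((q + 1) * s) := (List.take_append_drop _ _).symm
    obtain ⟨c₁, F₁, S₁, R, W, h₁, hneed₁, hc, -⟩ := h.exists_segment_of_keepsNeeded hneed _ _ ho
    have h5 := key h₁ hneed₁ (by rw [List.length_take]; omega)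
    have h6 : ∑ v ∈ (o.take ((q + 1) * s)).toFinset, (a v + b v) ≤
        ∑ v ∈ o.toFinset, (a v + b v) :=
      Finset.sum_le_sum_of_subset fun x hx => by
        rw [List.mem_toFinset] at hx ⊢
        exact List.mem_of_mem_take hx
    omega

end Segments

/-! ### Entropy estimates -/

/-- Dividing by `a + b` turns this into `2 min (p, 1 - p) ≤ H(p)` for the binary entropy `H`. -/
theorem mul_logb_add_two_mul_min_le {a b : ℝ} (ha : 0 ≤ a) (hb : 0 ≤ b) :
    a * Real.logb 2 a + b * Real.logb 2 b + 2 * min a b ≤ (a + b) * Real.logb 2 (a + b) := by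
  wlog hab : a ≤ b generalizing a b
  · have := this hb ha (le_of_not_ge hab)
    rw [min_comm, add_comm b a] at this
    linarith
  rw [min_eq_left hab]
  rcases ha.eq_or_lt with rfl | ha
  · simp
  have hb : 0 < b := ha.trans_le hab
  have hs : 0 < a + b := by positivity
  have hl2 : 0 < Real.log 2 := Real.log_pos (by norm_num)
  -- Concavity of the entropy between `0` and `1/2`.
  have hhalf : a / (a + b) ≤ 1 / 2 := by
    rw [div_le_div_iff₀ hs (by norm_num)]
    linarith
  have hc := Real.strictConcave_binEntropy.concaveOn.2
    (show (0 : ℝ) ∈ Set.Icc 0 1 by simp) (show (2⁻¹ : ℝ) ∈ Set.Icc 0 1 by constructor <;> norm_num)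
    (show 0 ≤ 1 - 2 * (a / (a + b)) by linarith) (show 0 ≤ 2 * (a / (a + b)) by positivity)
    (by ring)
  have hp : (1 - 2 * (a / (a + b))) • (0 : ℝ) + (2 * (a / (a + b))) • 2⁻¹ = a / (a + b) := by
    simp only [smul_eq_mul]; ring
  have h1 : 1 - a / (a + b) = b / (a + b) := by field_simp; ring
  rw [hp, Real.binEntropy_zero, Real.binEntropy_two_inv, Real.binEntropy, h1, Real.log_inv,
    Real.log_inv, Real.log_div ha.ne' hs.ne', Real.log_div hb.ne' hs.ne'] at hc
  simp only [smul_eq_mul, mul_zero, zero_add] at hc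
  have h2 : 2 * a * Real.log 2 ≤
      (a + b) * Real.log (a + b) - a * Real.log a - b * Real.log b := by
    have := mul_le_mul_of_nonneg_left hc hs.le
    have e1 : (a + b) * (2 * (a / (a + b)) * Real.log 2) = 2 * a * Real.log 2 := by field_simp
    have e2 : (a + b) * (a / (a + b) * -(Real.log a - Real.log (a + b)) +
        b / (a + b) * -(Real.log b - Real.log (a + b))) =
        (a + b) * Real.log (a + b) - a * Real.log a - b * Real.log b := by field_simp; ring
    linarith
  simp only [Real.logb]
  have h3 : 2 * a ≤
      ((a + b) * Real.log (a + b) - a * Real.log a - b * Real.log b) / Real.log 2 :=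
    (le_div_iff₀ hl2).2 h2
  have e3 : ((a + b) * Real.log (a + b) - a * Real.log a - b * Real.log b) / Real.log 2 =
    (a + b) * (Real.log (a + b) / Real.log 2) - a * (Real.log a / Real.log 2)
      - b * (Real.log b / Real.log 2) := by ring
  linarith

/-- The bound `D (1 + log₂ D)` for the number of vertices of a butterfly that can be computed from `D`
vertices, these included. Its value at `0` is `0`. -/
noncomputable def closureBound (D : ℕ) : ℝ := D * (1 + Real.logb 2 D)

theorem logb_two_nat_nonneg (D : ℕ) : 0 ≤ Real.logb 2 (D : ℝ) := by
  rcases Nat.eq_zero_or_pos D with rfl | h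
  · simp
  · exact Real.logb_nonneg (by norm_num) (by exact_mod_cast h)

theorem logb_two_nat_mono {a b : ℕ} (h : a ≤ b) : Real.logb 2 (a : ℝ) ≤ Real.logb 2 (b : ℝ) := by
  rcases Nat.eq_zero_or_pos a with rfl | ha
  · simpa using logb_two_nat_nonneg b
  · exact Real.logb_le_logb_of_le (by norm_num) (by exact_mod_cast ha) (by exact_mod_cast h)

theorem closureBound_add (a j : ℕ) : closureBound a + j ≤ closureBound (a + j) := by
  have h := logb_two_nat_mono (Nat.le_add_right a j)
  have h0 := logb_two_nat_nonneg (a + j)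
  have h1 : (a : ℝ) * Real.logb 2 (a : ℝ) ≤ a * Real.logb 2 ((a + j : ℕ) : ℝ) := by gcongr
  have h2 : 0 ≤ (j : ℝ) * Real.logb 2 ((a + j : ℕ) : ℝ) := by positivity
  simp only [closureBound]
  push_cast at *
  nlinarith

/-- This absorbs the last column of a butterfly generated by `a` and `b` elements in its halves. -/
theorem closureBound_add_two_mul_min (a b : ℕ) :
    closureBound a + closureBound b + 2 * min (a : ℝ) b ≤ closureBound (a + b) := by
  have := mul_logb_add_two_mul_min_le (Nat.cast_nonneg (α := ℝ) a) (Nat.cast_nonneg b)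
  simp only [closureBound]
  push_cast
  linarith

theorem closureBound_mono {a b : ℕ} (h : a ≤ b) : closureBound a ≤ closureBound b := by
  obtain ⟨j, rfl⟩ := Nat.exists_eq_add_of_le h
  have := closureBound_add a j
  have : (0 : ℝ) ≤ j := Nat.cast_nonneg j
  linarith

/-! ### Sets of butterfly vertices generated by few elements -/

/-- The vertices of the copy of `B_k` formed by the columns `0, …, k` of `B_l` and the rows that agree
with `w` in the bits `k, …, l - 1`. -/
def subButterfly {l : ℕ} (k : ℕ) (w : Fin l → Bool) : Finset (Fin (l + 1) × (Fin l → Bool)) :=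
  {p | (p.1 : ℕ) ≤ k ∧ ∀ b : Fin l, k ≤ b → p.2 b = w b}

theorem mem_subButterfly {l k : ℕ} {w : Fin l → Bool} {p : Fin (l + 1) × (Fin l → Bool)} :
    p ∈ subButterfly k w ↔ (p.1 : ℕ) ≤ k ∧ ∀ b : Fin l, k ≤ b → p.2 b = w b := by
  simp [subButterfly]

/-- Induction over the sub-butterflies, which also bounds the last column by the number of
generators: a column `k + 1` is joined to two copies of `B_k`, and a vertex generated in it needs an
operand in each, so that there are at most twice as many as in the smaller of the two. -/
theorem card_closed_inter_subButterfly_le {l : ℕ} (C I : Finset (Fin (l + 1) × (Fin l → Bool)))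
    (hC : ∀ v ∈ C, v ∉ I → (v.1 : ℕ) ≠ 0 ∧ ∀ u, (butterfly l).Adj u v → u ∈ C)
    (k : ℕ) (hk : k ≤ l) (w : Fin l → Bool) :
    ((C ∩ subButterfly k w).filter (fun p => (p.1 : ℕ) = k)).card ≤
      (I ∩ subButterfly k w).card ∧
    ((C ∩ subButterfly k w).card : ℝ) ≤ closureBound (I ∩ subButterfly k w).card := by
  induction k generalizing w with
  | zero =>
    have hsub : C ∩ subButterfly 0 w ⊆ I ∩ subButterfly 0 w := by
      intro v hv
      rw [Finset.mem_inter] at hv ⊢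
      refine ⟨?_, hv.2⟩
      by_contra hvI
      exact (hC v hv.1 hvI).1 (Nat.le_zero.1 (mem_subButterfly.1 hv.2).1)
    have hle := Finset.card_le_card hsub
    refine ⟨(Finset.card_filter_le _ _).trans hle, ?_⟩
    have := closureBound_add 0 (I ∩ subButterfly 0 w).card
    have h2 : ((C ∩ subButterfly 0 w).card : ℝ) ≤ (I ∩ subButterfly 0 w).card := by
      exact_mod_cast hle
    simp only [zero_add] at this
    simp only [closureBound, Nat.cast_zero, zero_mul, zero_add] at this ⊢
    linarith
  | succ k ih =>
    let bk : Fin l := ⟨k, hk⟩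
    let w' : Bool → (Fin l → Bool) := fun x => Function.update w bk x
    -- A sub-butterfly consists of two smaller ones and a last column.
    have hsplit : ∀ p, p ∈ subButterfly (k + 1) w ↔
        p ∈ subButterfly k (w' false) ∨ p ∈ subButterfly k (w' true) ∨
          (p ∈ subButterfly (k + 1) w ∧ (p.1 : ℕ) = k + 1) := by
      intro p
      constructor
      · intro hp
        by_cases h1 : (p.1 : ℕ) = k + 1
        · exact .inr (.inr ⟨hp, h1⟩)
        have hp' := mem_subButterfly.1 hp
        have : p ∈ subButterfly k (w' (p.2 bk)) := by
          refine mem_subButterfly.2 ⟨by omega, fun b hb => ?_⟩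
          by_cases hbk : b = bk
          · subst hbk; simp [w']
          · have : (b : ℕ) ≠ k := fun h => hbk (Fin.ext h)
            simp only [w', Function.update_of_ne hbk]
            exact hp'.2 b (by omega)
        cases hx : p.2 bk <;> rw [hx] at this <;> tauto
      · have aux : ∀ x, p ∈ subButterfly k (w' x) → p ∈ subButterfly (k + 1) w := by
          intro x hp
          have hp' := mem_subButterfly.1 hp
          refine mem_subButterfly.2 ⟨by omega, fun b hb => ?_⟩
          have hbk : b ≠ bk := fun h => by rw [h] at hb; simp [bk] at hb
          have := hp'.2 b (by omega)
          simpa [w', Function.update_of_ne hbk] using this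
        rintro (h | h | h)
        exacts [aux _ h, aux _ h, h.1]
    have hdisj : ∀ p, p ∈ subButterfly k (w' false) → p ∉ subButterfly k (w' true) := by
      intro p h1 h2
      have e1 := (mem_subButterfly.1 h1).2 bk le_rfl
      have e2 := (mem_subButterfly.1 h2).2 bk le_rfl
      simp [w'] at e1 e2
      simp [e1] at e2
    have hcol : ∀ x p, p ∈ subButterfly k (w' x) → (p.1 : ℕ) ≠ k + 1 := by
      intro x p hp
      have := (mem_subButterfly.1 hp).1
      omega
    have hcount : ∀ A : Finset (Fin (l + 1) × (Fin l → Bool)),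
        (A ∩ subButterfly (k + 1) w).card = (A ∩ subButterfly k (w' false)).card +
          (A ∩ subButterfly k (w' true)).card +
          ((A ∩ subButterfly (k + 1) w).filter (fun p => (p.1 : ℕ) = k + 1)).card := by
      intro A
      rw [← Finset.card_union_of_disjoint, ← Finset.card_union_of_disjoint]
      · congr 1
        ext p
        have := hsplit p
        simp only [Finset.mem_union, Finset.mem_inter, Finset.mem_filter]
        tauto
      · rw [Finset.disjoint_left]
        intro p hp hp'
        have h0 := hcol false p
        have h1 := hcol true p
        simp only [Finset.mem_union, Finset.mem_inter, Finset.mem_filter] at hp hp'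
        tauto
      · rw [Finset.disjoint_left]
        intro p hp hp'
        simp only [Finset.mem_inter] at hp hp'
        exact hdisj p hp.2 hp'.2
    set J := (I ∩ subButterfly (k + 1) w).filter (fun p => (p.1 : ℕ) = k + 1)
    set L := (C ∩ subButterfly (k + 1) w).filter (fun p => (p.1 : ℕ) = k + 1)
    -- The vertices of the last column that are not themselves generators.
    -- Each has an operand in the last column of either half, and this operand serves two of them.
    have hgen : ∀ x, (L \ J).card ≤ 2 * (I ∩ subButterfly k (w' x)).card := by
      intro x
      let f : Fin (l + 1) × (Fin l → Bool) → Fin (l + 1) × (Fin l → Bool) :=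
        fun p => (⟨k, by omega⟩, Function.update p.2 bk x)
      have hmaps : ∀ p ∈ L \ J, f p ∈
          (C ∩ subButterfly k (w' x)).filter (fun p => (p.1 : ℕ) = k) := by
        intro p hp
        simp only [L, J, Finset.mem_sdiff, Finset.mem_filter, Finset.mem_inter] at hp
        obtain ⟨⟨⟨hpC, hpS⟩, hpk⟩, hpJ⟩ := hp
        have hpI : p ∉ I := fun h => hpJ ⟨⟨h, hpS⟩, hpk⟩
        have hadj : (butterfly l).Adj (f p) p := by
          refine ⟨by simp [f, hpk], fun b hb => ?_⟩
          have hbk : b ≠ bk := fun h => hb (by simp [f, h, bk])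
          simp [f, Function.update_of_ne hbk]
        simp only [Finset.mem_filter, Finset.mem_inter]
        refine ⟨⟨(hC p hpC hpI).2 _ hadj, mem_subButterfly.2 ⟨by simp [f], fun b hb => ?_⟩⟩,
          by simp [f]⟩
        by_cases hbk : b = bk
        · subst hbk; simp [f, w']
        · have : (b : ℕ) ≠ k := fun h => hbk (Fin.ext h)
          simp only [f, w', Function.update_of_ne hbk]
          exact (mem_subButterfly.1 hpS).2 b (by omega)
      have hfib : ∀ y ∈ (C ∩ subButterfly k (w' x)).filter (fun p => (p.1 : ℕ) = k),
          ((L \ J).filter (fun p => f p = y)).card ≤ 2 := by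
        intro y _
        rw [← Fintype.card_bool, ← Finset.card_univ]
        refine Finset.card_le_card_of_injOn (fun p => p.2 bk) (fun _ _ => Finset.mem_univ _) ?_
        intro p hp p' hp' hpp
        simp only [L, Finset.coe_filter, Finset.mem_sdiff, Finset.mem_filter,
          Set.mem_ofPred_eq] at hp hp'
        have hff : f p = f p' := hp.2.trans hp'.2.symm
        refine Prod.ext (Fin.ext (hp.1.1.2.trans hp'.1.1.2.symm)) (funext fun b => ?_)
        by_cases hbk : b = bk
        · subst hbk; exact hpp
        · have := congrFun (congrArg Prod.snd hff) b
          simpa [f, Function.update_of_ne hbk] using this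
      have := Finset.card_le_mul_card_image_of_maps_to hmaps 2 hfib
      exact this.trans (Nat.mul_le_mul_left 2 (ih (by omega) (w' x)).1)
    have hLJ : L.card ≤ (L \ J).card + J.card := by
      have := Finset.le_card_sdiff J L
      omega
    have g0 := hgen false
    have g1 := hgen true
    have i0 := (ih (by omega) (w' false)).2
    have i1 := (ih (by omega) (w' true)).2
    have hcI : _ = _ + J.card := hcount I
    have hcC : _ = _ + L.card := hcount C
    set D0 := (I ∩ subButterfly k (w' false)).card
    set D1 := (I ∩ subButterfly k (w' true)).card
    refine ⟨by omega, ?_⟩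
    rw [hcI, hcC]
    have hmin : ((L \ J).card : ℝ) ≤ 2 * min (D0 : ℝ) D1 := by
      rw [← Nat.cast_min]
      have : (L \ J).card ≤ 2 * min D0 D1 := by omega
      exact_mod_cast this
    have h3 := closureBound_add_two_mul_min D0 D1
    have h4 := closureBound_add (D0 + D1) J.card
    have h5 : (L.card : ℝ) ≤ (L \ J).card + J.card := by exact_mod_cast hLJ
    push_cast
    linarith

/-- The Hong–Kung bound: a set of vertices of the butterfly that is computed from `D` elements has at
most `D (1 + log₂ D)` elements. -/
theorem card_le_closureBound {l : ℕ} {C I : Finset (Fin (l + 1) × (Fin l → Bool))}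
    (hC : ∀ v ∈ C, v ∉ I → (v.1 : ℕ) ≠ 0 ∧ ∀ u, (butterfly l).Adj u v → u ∈ C) :
    (C.card : ℝ) ≤ closureBound I.card := by
  have h := (card_closed_inter_subButterfly_le C I hC l le_rfl (fun _ => false)).2
  have huniv : subButterfly l (fun _ : Fin l => false) = Finset.univ := by
    ext p
    simp only [mem_subButterfly, Finset.mem_univ, iff_true]
    exact ⟨by omega, fun b hb => absurd b.2 (by omega)⟩
  simpa [huniv] using h

/-- The symmetry of the butterfly that reverses the columns, the bits and all edges. -/
def butterflyRev (l : ℕ) :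
    (Fin (l + 1) × (Fin l → Bool)) ≃ (Fin (l + 1) × (Fin l → Bool)) :=
  Equiv.prodCongr Fin.revPerm (Equiv.arrowCongr Fin.revPerm (Equiv.refl Bool))

theorem butterfly_adj_rev {l : ℕ} {p q : Fin (l + 1) × (Fin l → Bool)}
    (h : (butterfly l).Adj (butterflyRev l p) q) : (butterfly l).Adj ((butterflyRev l).symm q) p := by
  obtain ⟨h1, h2⟩ := h
  simp only [butterflyRev, Equiv.prodCongr_apply, Prod.map_fst, Prod.map_snd, Fin.revPerm_apply,
    Fin.val_rev] at h1 h2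
  refine ⟨?_, fun b hb => ?_⟩
  · simp [butterflyRev, Fin.val_rev]
    omega
  · simp [butterflyRev, Fin.val_rev] at hb
    have := h2 b.rev (by rw [Fin.val_rev]; omega)
    simp [butterflyRev, Equiv.arrowCongr] at this ⊢
    exact this.symm

theorem card_le_closureBound_rev {l : ℕ} {C I : Finset (Fin (l + 1) × (Fin l → Bool))}
    (hC : ∀ v ∈ C, v ∉ I → (v.1 : ℕ) ≠ l ∧ ∀ u, (butterfly l).Adj v u → u ∈ C) :
    (C.card : ℝ) ≤ closureBound I.card := by
  have h := card_le_closureBound (C := C.map (butterflyRev l).toEmbedding)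
    (I := I.map (butterflyRev l).toEmbedding) (by
      intro v hv hvI
      rw [Finset.mem_map_equiv] at hv hvI
      obtain ⟨h1, h2⟩ := hC _ hv hvI
      refine ⟨?_, fun u hu => ?_⟩
      · simp [butterflyRev, Fin.val_rev] at h1
        omega
      · rw [Finset.mem_map_equiv]
        refine h2 _ ?_
        exact butterfly_adj_rev (by simpa using hu))
  simpa using h

/-! ### Boundaries of segments of the butterfly -/

/-- An input in `T` counts twice: it is not computed from operands, and it is a generator that is not
in the boundary. -/
theorem le_card_operandBoundary {l s D : ℕ} (hD : 3 ≤ D)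
    (hs : ((D - 1 : ℕ) : ℝ) * Real.logb 2 ((D - 1 : ℕ) : ℝ) < s)
    (T : Finset (Fin (l + 1) × (Fin l → Bool))) (hT : T.card = s) :
    D ≤ (operandBoundary (butterfly l) T).card + ∑ v ∈ T, if (v.1 : ℕ) = 0 then 2 else 0 := by
  set B := operandBoundary (butterfly l) T
  have hBT : Disjoint B T := by
    rw [Finset.disjoint_left]
    intro u hu
    simp only [B, operandBoundary, Finset.mem_filter] at hu
    exact hu.2.1
  -- `T` together with its operands is generated by the operands and the inputs in `T`.
  have hcl := card_le_closureBound (C := B ∪ T) (I := B ∪ T.filter (fun v => (v.1 : ℕ) = 0)) (by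
    intro v hv hvI
    simp only [Finset.mem_union, Finset.mem_filter] at hv hvI
    have hvT : v ∈ T := by tauto
    refine ⟨by tauto, fun u hu => ?_⟩
    by_cases huT : u ∈ T
    · exact Finset.mem_union_right _ huT
    · refine Finset.mem_union_left _ ?_
      simp only [B, operandBoundary, Finset.mem_filter, Finset.mem_univ, true_and]
      exact ⟨huT, v, hvT, hu⟩)
  rw [Finset.card_union_of_disjoint hBT,
    Finset.card_union_of_disjoint (hBT.mono_right (Finset.filter_subset _ _)), hT] at hcl
  rw [← Finset.sum_filter, Finset.sum_const, smul_eq_mul]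
  set σ := (T.filter (fun v => (v.1 : ℕ) = 0)).card
  by_contra hlt
  have hle : B.card + σ + σ ≤ D - 1 := by omega
  have hlog : Real.logb 2 ((B.card + σ : ℕ) : ℝ) ≤ Real.logb 2 ((D - 1 : ℕ) : ℝ) :=
    logb_two_nat_mono (by omega)
  have hone : 1 ≤ Real.logb 2 ((D - 1 : ℕ) : ℝ) := by
    have := logb_two_nat_mono (show 2 ≤ D - 1 by omega)
    simpa using this
  have hle' : ((B.card + σ : ℕ) : ℝ) + σ ≤ ((D - 1 : ℕ) : ℝ) := by exact_mod_cast hle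
  have h1 : ((B.card + σ : ℕ) : ℝ) * Real.logb 2 ((B.card + σ : ℕ) : ℝ) ≤
      (((D - 1 : ℕ) : ℝ) - σ) * Real.logb 2 ((D - 1 : ℕ) : ℝ) :=
    mul_le_mul (by linarith) hlog (logb_two_nat_nonneg _)
      (by have := Nat.cast_nonneg (α := ℝ) (B.card + σ); linarith)
  have h2 : (σ : ℝ) * 1 ≤ σ * Real.logb 2 ((D - 1 : ℕ) : ℝ) := by gcongr
  simp only [closureBound, mul_add, mul_one] at hcl
  push_cast at hcl h1 h2
  linarith

theorem le_card_resultBoundary {l s D : ℕ} (hs : closureBound (D - 1) < s)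
    (T : Finset (Fin (l + 1) × (Fin l → Bool))) (hT : T.card = s) :
    D ≤ (resultBoundary (butterfly l) T).card + ∑ v ∈ T, if (v.1 : ℕ) = l then 1 else 0 := by
  set B := resultBoundary (butterfly l) T
  -- In the reversed butterfly, `T` is generated by its results and the outputs in `T`.
  have hcl := card_le_closureBound_rev (C := T) (I := B ∪ T.filter (fun v => (v.1 : ℕ) = l)) (by
    intro v hv hvI
    simp only [Finset.mem_union, Finset.mem_filter] at hvI
    refine ⟨by tauto, fun u hu => ?_⟩
    by_contra huT
    refine hvI (.inl ?_)
    simp only [B, resultBoundary, Finset.mem_filter, Finset.mem_univ, true_and]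
    exact ⟨hv, u, huT, hu⟩)
  rw [hT] at hcl
  rw [← Finset.sum_filter, Finset.sum_const, smul_eq_mul, mul_one]
  by_contra hlt
  have h1 := Finset.card_union_le B (T.filter (fun v => (v.1 : ℕ) = l))
  have h2 := closureBound_mono (show _ ≤ D - 1 from h1.trans (by omega))
  linarith

theorem card_column {l k : ℕ} (hk : k ≤ l) :
    (Finset.univ.filter fun v : Fin (l + 1) × (Fin l → Bool) => (v.1 : ℕ) = k).card = 2 ^ l := by
  have : (Finset.univ.filter fun v : Fin (l + 1) × (Fin l → Bool) => (v.1 : ℕ) = k) =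
      {(⟨k, by omega⟩ : Fin (l + 1))} ×ˢ Finset.univ := by
    ext v
    simp only [Finset.mem_filter, Finset.mem_univ, true_and, Finset.mem_product,
      Finset.mem_singleton, Fin.ext_iff, and_true]
  rw [this, Finset.card_product]
  simp

/-- The segment bound for the butterfly: each of the `2 ^ l` inputs costs at most `2` in the read
bounds of the segments, and each of the `2 ^ l` outputs at most `1` in the write bounds. -/
theorem Run.butterfly_segment_bound {l M s D D' : ℕ} (hD : 3 ≤ D)
    (hs : ((D - 1 : ℕ) : ℝ) * Real.logb 2 ((D - 1 : ℕ) : ℝ) < s) (hs' : closureBound (D' - 1) < s)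
    {o : List (Fin (l + 1) × (Fin l → Bool))} {c : ℕ}
    {F S : Finset (Fin (l + 1) × (Fin l → Bool))}
    (h : Run (butterfly l) M o c F S) (ho : ∀ v, v ∈ o) :
    ((l + 1) * 2 ^ l / s) * ((D - M) + (D' - M)) ≤ c + 3 * 2 ^ l := by
  have huniv : o.toFinset = Finset.univ := by
    ext v
    simp [ho]
  have hlen : o.length = (l + 1) * 2 ^ l := by
    rw [← List.toFinset_card_of_nodup h.nodup, huniv]
    simp
  have := h.segment_bound (le_card_operandBoundary hD hs) (le_card_resultBoundary hs')
    ((l + 1) * 2 ^ l / s) (fun u _ v hv => absurd (ho v) hv)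
    (by rw [hlen]; exact Nat.div_mul_le_self _ _)
  rw [huniv, Finset.sum_add_distrib, ← Finset.sum_filter, ← Finset.sum_filter, Finset.sum_const,
    Finset.sum_const, card_column (Nat.zero_le l), card_column le_rfl] at this
  simp only [smul_eq_mul] at this
  omega

/-! ### The closed form -/

/-- Removes the rounding in the number `n / s` of segments at the cost of one further `L`. -/
theorem le_of_segments {n s v c L : ℕ} (hs : 0 < s) (h : n / s * v ≤ c + 3 * L) (hv : v ≤ L) :
    (n : ℝ) * (v / s) - 4 * L ≤ c := by
  have hs' : (0 : ℝ) < s := by exact_mod_cast hs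
  have h1 : (n : ℝ) / s ≤ (n / s : ℕ) + 1 := by
    rw [div_le_iff₀ hs']
    have := Nat.div_add_mod n s
    have := Nat.mod_lt n hs
    have : n ≤ (n / s + 1) * s := by nlinarith
    exact_mod_cast this
  have h2 : ((n / s : ℕ) : ℝ) * v ≤ c + 3 * L := by exact_mod_cast h
  have h3 : (v : ℝ) ≤ L := by exact_mod_cast hv
  have h4 : (n : ℝ) * (v / s) ≤ ((n / s : ℕ) + 1) * v := by
    have := mul_le_mul_of_nonneg_right h1 (Nat.cast_nonneg (α := ℝ) v)
    calc (n : ℝ) * (v / s) = n / s * v := by ring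
      _ ≤ _ := this
  linarith

theorem fftBound_eq (l M : ℕ) : fftBound l M =
    (((l + 1) * 2 ^ l : ℕ) : ℝ) * (1 - Real.cos (Real.pi / (2 * Real.logb 2 (M : ℝ) + 1))) -
      4 * ((2 ^ l : ℕ) : ℝ) := by
  have : (l : ℝ) + 1 ≠ 0 := by positivity
  simp only [fftBound]
  push_cast
  field_simp

theorem logb_two_three_lt : Real.logb 2 3 < 5 / 3 := by
  have h : Real.logb 2 (3 ^ (3 : ℕ)) < Real.logb 2 (2 ^ (5 : ℕ)) :=
    Real.logb_lt_logb (by norm_num) (by norm_num) (by norm_num)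
  rw [Real.logb_pow, Real.logb_pow, Real.logb_self_eq_one (by norm_num)] at h
  push_cast at h
  linarith

theorem lt_logb_two_three : 3 / 2 < Real.logb 2 3 := by
  have h : Real.logb 2 (2 ^ (3 : ℕ)) < Real.logb 2 (3 ^ (2 : ℕ)) :=
    Real.logb_lt_logb (by norm_num) (by norm_num) (by norm_num)
  rw [Real.logb_pow, Real.logb_pow, Real.logb_self_eq_one (by norm_num)] at h
  push_cast at h
  linarith

/-- For `M = 2` a segment of `8` vertices forces two reads and two writes, which is the coefficient
`1 - cos (π / 3) = 1 / 2` exactly. -/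
theorem fftBound_two_le_of_run {l : ℕ} {o : List (Fin (l + 1) × (Fin l → Bool))} {c : ℕ}
    {F S : Finset (Fin (l + 1) × (Fin l → Bool))}
    (h : Run (butterfly l) 2 o c F S) (ho : ∀ v, v ∈ o) : fftBound l 2 ≤ c := by
  have hcos : 1 - Real.cos (Real.pi / (2 * Real.logb 2 ((2 : ℕ) : ℝ) + 1)) = 1 / 2 := by
    rw [Nat.cast_ofNat, Real.logb_self_eq_one (by norm_num),
      show (2 * 1 + 1 : ℝ) = 3 by norm_num, Real.cos_pi_div_three]
    norm_num
  have hl3 := logb_two_three_lt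
  have hb := h.butterfly_segment_bound (s := 8) (D := 4) (D' := 4) (by norm_num)
    (by norm_num; linarith) (by norm_num [closureBound]; linarith) ho
  rw [fftBound_eq, hcos]
  -- For `l < 2` the bound is negative.
  rcases Nat.lt_or_ge l 2 with hl | hl
  · have : (0 : ℝ) ≤ c := Nat.cast_nonneg c
    interval_cases l <;> norm_num <;> linarith
  · have := le_of_segments (s := 8) (v := 4) (L := 2 ^ l) (by norm_num) hb
      (Nat.pow_le_pow_right (n := 2) (by norm_num) hl)
    norm_num at this ⊢
    linarith

/-- For `M ≥ 3`, segments of `4 M log₂ (4 M)` vertices have at least `4 M` operands and `3 M` results,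
hence force `5 M` I/Os. -/
theorem fftBound_le_of_run_of_three_le {l M : ℕ} (hM : 3 ≤ M)
    {o : List (Fin (l + 1) × (Fin l → Bool))} {c : ℕ}
    {F S : Finset (Fin (l + 1) × (Fin l → Bool))}
    (h : Run (butterfly l) M o c F S) (ho : ∀ v, v ∈ o) : fftBound l M ≤ c := by
  set m := Real.logb 2 (M : ℝ) with hm
  have hl3 := logb_two_three_lt
  have hM0 : (3 : ℝ) ≤ M := by exact_mod_cast hM
  have hm3 : 3 / 2 < m := lt_logb_two_three.trans_le (by simpa using logb_two_nat_mono hM)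
  have h4 : Real.logb 2 ((4 * M : ℕ) : ℝ) = m + 2 := by
    rw [Nat.cast_mul, Real.logb_mul (by norm_num) (by positivity),
      show ((4 : ℕ) : ℝ) = 2 ^ (2 : ℕ) by norm_num, Real.logb_pow,
      Real.logb_self_eq_one (by norm_num)]
    push_cast
    ring
  have h3 : Real.logb 2 ((3 * M : ℕ) : ℝ) = m + Real.logb 2 3 := by
    rw [Nat.cast_mul, Real.logb_mul (by norm_num) (by positivity)]
    push_cast
    ring
  have hpos : 0 ≤ 4 * (M : ℝ) * (m + 2) := by positivity
  set s := ⌊4 * (M : ℝ) * (m + 2)⌋₊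
  have hs1 : (s : ℝ) ≤ 4 * (M : ℝ) * (m + 2) := Nat.floor_le hpos
  have hs2 : 4 * (M : ℝ) * (m + 2) - 1 < s := by
    have := Nat.lt_floor_add_one (4 * (M : ℝ) * (m + 2))
    linarith
  have hs0 : (0 : ℝ) < s := by nlinarith
  have c4 : ((4 * M - 1 : ℕ) : ℝ) = 4 * M - 1 := by
    rw [Nat.cast_sub (by omega)]
    push_cast
    ring
  have c3 : ((3 * M - 1 : ℕ) : ℝ) = 3 * M - 1 := by
    rw [Nat.cast_sub (by omega)]
    push_cast
    ring
  have hb := h.butterfly_segment_bound (s := s) (D := 4 * M) (D' := 3 * M) (by omega)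
    (by
      have := logb_two_nat_mono (Nat.sub_le (4 * M) 1)
      rw [h4] at this
      rw [c4] at this ⊢
      have := mul_le_mul_of_nonneg_left this (show 0 ≤ 4 * (M : ℝ) - 1 by linarith)
      linarith)
    (by
      have := logb_two_nat_mono (Nat.sub_le (3 * M) 1)
      rw [h3] at this
      simp only [closureBound]
      rw [c3] at this ⊢
      -- `log₂ 3 < 5 / 3` gives `1 + log₂ (3 M) ≤ (4 / 3) log₂ (4 M)`.
      have := mul_le_mul_of_nonneg_left
        (show 1 + Real.logb 2 (3 * (M : ℝ) - 1) ≤ 4 / 3 * (m + 2) by linarith)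
        (show 0 ≤ 3 * (M : ℝ) - 1 by linarith)
      linarith) ho
  rw [show 4 * M - M + (3 * M - M) = 5 * M by omega] at hb
  have hratio : 5 / 4 / (m + 2) ≤ ((5 * M : ℕ) : ℝ) / s := by
    rw [div_le_div_iff₀ (by linarith) hs0]
    push_cast
    linarith
  have hcos : 1 - Real.cos (Real.pi / (2 * m + 1)) ≤ 5 / 4 / (m + 2) := by
    have h1 := Real.one_sub_sq_div_two_le_cos (x := Real.pi / (2 * m + 1))
    have hpi : Real.pi ^ 2 < 10 := by nlinarith [Real.pi_lt_d2, Real.pi_pos]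
    have h2 : (Real.pi / (2 * m + 1)) ^ 2 / 2 ≤ 5 / 4 / (m + 2) := by
      rw [div_pow, div_div, div_le_div_iff₀ (by positivity) (by linarith)]
      nlinarith
    linarith
  rw [fftBound_eq, ← hm]
  by_cases hv : 5 * M ≤ 2 ^ l
  · have h1 := le_of_segments (by exact_mod_cast hs0) hb hv
    have h2 := mul_le_mul_of_nonneg_left (hcos.trans hratio)
      (Nat.cast_nonneg (α := ℝ) ((l + 1) * 2 ^ l))
    linarith
  · -- In small butterflies the bound is negative.
    have hl : (l : ℝ) < m + 3 := by
      have h1 : ((2 ^ l : ℕ) : ℝ) < 2 ^ (3 : ℕ) * M := by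
        have : 2 ^ l < 8 * M := by omega
        norm_num
        exact_mod_cast this
      have h2 := Real.logb_lt_logb (b := 2) (by norm_num) (by positivity) h1
      rw [Nat.cast_pow, Nat.cast_ofNat, Real.logb_pow, Real.logb_mul (by norm_num) (by positivity),
        Real.logb_pow, Real.logb_self_eq_one (by norm_num)] at h2
      push_cast at h2
      linarith
    have h1 : ((l : ℝ) + 1) * (1 - Real.cos (Real.pi / (2 * m + 1))) ≤ 4 := by
      have h2 := mul_le_mul_of_nonneg_left hcos (show 0 ≤ (l : ℝ) + 1 by positivity)
      have h3 : ((l : ℝ) + 1) * (5 / 4 / (m + 2)) ≤ 4 := by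
        rw [← mul_div_assoc, div_le_iff₀ (by linarith)]
        linarith
      linarith
    have h2 := mul_le_mul_of_nonneg_left h1 (show (0 : ℝ) ≤ 2 ^ l by positivity)
    have : (0 : ℝ) ≤ c := Nat.cast_nonneg c
    push_cast
    linarith

theorem fftBound_le_optIO {l M : ℕ} (hM : 2 ≤ M) :
    ((fftBound l M : ℝ) : EReal) ≤ ((optIO (butterfly l) M : ENNReal) : EReal) := by
  have h : ((⌈fftBound l M⌉₊ : ℕ) : ℕ∞) ≤ optIO (butterfly l) M := by
    refine le_iInf fun X => le_iInf fun _ => le_iInf fun c => le_iInf fun hc => ?_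
    obtain ⟨F, S, hr⟩ := hc
    have ho : ∀ v, v ∈ List.ofFn X := fun v => by
      rw [List.mem_ofFn]
      exact X.surjective v
    rw [Nat.cast_le, Nat.ceil_le]
    rcases hM.eq_or_lt with rfl | hM
    · exact fftBound_two_le_of_run hr ho
    · exact fftBound_le_of_run_of_three_le hM hr ho
  have h1 : (((⌈fftBound l M⌉₊ : ℕ) : ENNReal) : EReal) ≤
      ((optIO (butterfly l) M : ENNReal) : EReal) := by
    rw [EReal.coe_ennreal_le_coe_ennreal_iff]
    exact_mod_cast h
  refine le_trans ?_ h1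
  have h2 : (((⌈fftBound l M⌉₊ : ℕ) : ENNReal) : EReal) = ((⌈fftBound l M⌉₊ : ℝ) : EReal) := by
    norm_cast
  rw [h2, EReal.coe_le_coe_iff]
  exact Nat.le_ceil _

theorem fftBound_asymptotic : ∃ l₀ : ℕ, ∀ l M : ℕ, l₀ ≤ l → 2 ≤ M → M ≤ l →
    1 / 9 * ((l : ℝ) * 2 ^ l / Real.logb 2 (M : ℝ) ^ 2) ≤ fftBound l M := by
  have hlim : ∀ᶠ l : ℕ in Filter.atTop, 36 * Real.logb 2 (l : ℝ) ^ 2 ≤ l := by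
    have h := (Real.isLittleO_pow_log_id_atTop (n := 2)).comp_tendsto tendsto_natCast_atTop_atTop
    have hl2 : 0 < Real.log 2 := Real.log_pos (by norm_num)
    filter_upwards [h.def (show 0 < Real.log 2 ^ 2 / 36 by positivity)] with l hl
    simp only [Function.comp_apply, id, Real.norm_eq_abs, abs_pow, sq_abs, Nat.abs_cast] at hl
    rw [Real.logb, div_pow, ← mul_div_assoc, div_le_iff₀ (by positivity)]
    linarith
  obtain ⟨l₀, hl₀⟩ := Filter.eventually_atTop.1 hlim
  refine ⟨l₀, fun l M hl hM hMl => ?_⟩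
  have h36 := hl₀ l hl
  set m := Real.logb 2 (M : ℝ) with hm
  have hm1 : 1 ≤ m := by simpa using logb_two_nat_mono hM
  have hml : m ≤ Real.logb 2 (l : ℝ) := logb_two_nat_mono hMl
  have hm36 : 36 * m ^ 2 ≤ l := by
    have : m ^ 2 ≤ Real.logb 2 (l : ℝ) ^ 2 := by gcongr
    linarith
  have hcos : 2 / (9 * m ^ 2) ≤ 1 - Real.cos (Real.pi / (2 * m + 1)) := by
    have h1 := Real.cos_le_one_sub_mul_cos_sq (x := Real.pi / (2 * m + 1)) (by
      rw [abs_of_nonneg (by positivity)]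
      exact div_le_self Real.pi_pos.le (by linarith))
    have h2 : 2 / Real.pi ^ 2 * (Real.pi / (2 * m + 1)) ^ 2 = 2 / (2 * m + 1) ^ 2 := by
      field_simp
    have h3 : 2 / (9 * m ^ 2) ≤ 2 / (2 * m + 1) ^ 2 := by
      gcongr
      nlinarith
    linarith
  -- For large `l` the subtracted term `4` is at most half of the main term.
  have h4 : (4 : ℝ) ≤ 1 / 9 * (l / m ^ 2) := by
    have : (36 : ℝ) ≤ l / m ^ 2 := by rwa [le_div_iff₀ (by positivity)]
    linarith
  have h5 : (l : ℝ) * (2 / (9 * m ^ 2)) ≤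
      ((l : ℝ) + 1) * (1 - Real.cos (Real.pi / (2 * m + 1))) := by
    have h0 : 0 ≤ 2 / (9 * m ^ 2) := by positivity
    gcongr
    linarith
  have h6 : (l : ℝ) * (2 / (9 * m ^ 2)) = 2 * (1 / 9 * (l / m ^ 2)) := by field_simp
  have h7 := mul_le_mul_of_nonneg_left (show 1 / 9 * (l / m ^ 2) ≤
    ((l : ℝ) + 1) * (1 - Real.cos (Real.pi / (2 * m + 1))) - 4 by linarith)
    (show (0 : ℝ) ≤ 2 ^ l by positivity)
  rw [fftBound_eq, ← hm]
  push_cast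
  calc 1 / 9 * ((l : ℝ) * 2 ^ l / m ^ 2) = 2 ^ l * (1 / 9 * (l / m ^ 2)) := by ring
    _ ≤ _ := h7
    _ = _ := by ring

end IOModel

theorem mainTheorem8 :
    -- the closed-form bound
    (∀ l M : ℕ, 2 ≤ M →
      ((IOModel.fftBound l M : ℝ) : EReal) ≤
        ((IOModel.optIO (IOModel.butterfly l) M : ENNReal) : EReal)) ∧
    -- its asymptotics for `M ≪ l`, and the comparison with `l 2 ^ l / log M`
    (∃ c : ℝ, 0 < c ∧ ∃ l₀ : ℕ, ∀ l M : ℕ, l₀ ≤ l → 2 ≤ M → M ≤ l →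
      c * ((l : ℝ) * 2 ^ l / Real.logb 2 (M : ℝ) ^ 2) ≤ IOModel.fftBound l M ∧
      c * (1 / Real.logb 2 (M : ℝ)) * ((l : ℝ) * 2 ^ l / Real.logb 2 (M : ℝ)) ≤
        IOModel.fftBound l M) := by
  refine ⟨fun l M hM => IOModel.fftBound_le_optIO hM, 1 / 9, by norm_num, ?_⟩
  obtain ⟨l₀, h⟩ := IOModel.fftBound_asymptotic
  refine ⟨l₀, fun l M hl hM hMl => ⟨h l M hl hM hMl, ?_⟩⟩
  calc _ = 1 / 9 * ((l : ℝ) * 2 ^ l / Real.logb 2 (M : ℝ) ^ 2) := by ring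
    _ ≤ _ := h l M hl hM hMl
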